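/- Let $N$ be a finite set with power set $\mathcal P(N)$. The entropy function of a random vector $(\xi_i)_{i\in N}$, whose components are defined on a common probability space and take finitely many values, is the point of $\mathbb R^{\mathcal P(N)}$ that assigns to each $I\subseteq N$ the Shannon entropy (with natural logarithm) of the subvector $(\xi_i)_{i\in I}$. The entropy region $\mathbf H^{\mathrm{ent}}_N\subseteq\mathbb R^{\mathcal P(N)}$ is the set of all such entropy functions, and a function $h\in\mathbb R^{\mathcal P(N)}$ is called almost entropic if it lies in the closure of $\mathbf H^{\mathrm{ent}}_N$ in the Euclidean space $\mathbb R^{\mathcal P(N)}$. The tight part of $h$ is the function $h^{\mathrm{ti}}\in\mathbb R^{\mathcal P(N)}$ given by $$h^{\mathrm{ti}}(I)=h(I)-\sum_{i\in I}\bigl[h(N)-h(N\setminus\{i\})\bigr],\qquad I\subseteq N.$$ Theorem. If $h$ is almost entropic, then its tight part $h^{\mathrm{ti}}$ is almost entropic. -/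

import Mathlib

open MeasureTheory

/-- Shannon entropy (natural logarithm) of a random variable `Y` on `(Ω, P)` with values in a
finite set `A`: `- ∑ a, P(Y = a) log P(Y = a)`, with `0 log 0 = 0`. -/
noncomputable def shannonEntropy {Ω A : Type*} [MeasurableSpace Ω] [Fintype A]
    (P : Measure Ω) (Y : Ω → A) : ℝ :=
  ∑ a : A, Real.negMulLog (P.real (Y ⁻¹' {a}))

/-- The entropy function of a random vector `(ξ i)_{i ∈ N}`: it maps each `I ⊆ N` to the Shannon
entropy of the subvector `(ξ i)_{i ∈ I}`. -/
noncomputable def entropyFunction {N Ω : Type*} [DecidableEq N] [MeasurableSpace Ω]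
    (P : Measure Ω) {X : N → Type*} [∀ i, Fintype (X i)] (ξ : ∀ i, Ω → X i) :
    Finset N → ℝ :=
  fun I => shannonEntropy P (fun ω (i : I) => ξ i ω)

/-- The entropy region in `ℝ^{𝒫(N)}`: all entropy functions of random vectors indexed by `N` whose
components take values in finite sets (with the discrete σ-algebra) and live on a common
probability space. -/
def entropyRegion (N : Type*) [DecidableEq N] : Set (Finset N → ℝ) :=
  {h | ∃ (Ω : Type) (_ : MeasurableSpace Ω) (P : Measure Ω) (_ : IsProbabilityMeasure P)
      (X : N → Type) (_ : ∀ i, Fintype (X i)) (ξ : ∀ i, Ω → X i),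
      (∀ i, Measurable[_, ⊤] (ξ i)) ∧ h = entropyFunction P ξ}

/-- `h` is almost entropic if it lies in the closure of the entropy region. -/
def AlmostEntropic {N : Type*} [DecidableEq N] (h : Finset N → ℝ) : Prop :=
  h ∈ closure (entropyRegion N)

/-- The tight part `h^ti(I) = h(I) - ∑_{i ∈ I} [h(N) - h(N ∖ i)]`. -/
def tightPart {N : Type*} [Fintype N] [DecidableEq N] (h : Finset N → ℝ) : Finset N → ℝ :=
  fun I => h I - ∑ i ∈ I, (h Finset.univ - h (Finset.univ.erase i))

/-! It suffices to tighten at one element `i`. For entropic $h$, the amount to remove is $t =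
h(N)-h(N\setminus i)$, the entropy of $\xi_i$ given the other components. Suppose $W$ is a function
of $\xi_i$ with entropy about $t$ and almost independent of the other components. Conditioning on
$W$ lowers the entropy of $I$ by about $t$ when $i\in I$ and barely changes it when $i\notin I$.
Conditional entropies are averages of entropy functions, and the closure of the entropy region is a
convex cone (`AlmostEntropic.add`, `AlmostEntropic.smul`), so they stay almost entropic
(`almostEntropic_conditional`).

Such a $W$ is found by random hashing (`exists_hash`) into about $e^t$ values, with an error
governed by the fluctuation of the conditional surprisal (`exists_almostEntropic_near_tightenAt`).
For $n$ independent copies (`exists_iid_copies`) that fluctuation is $O(\sqrt n)$ while entropies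
grow like $n$. Dividing by $n$ and letting $n\to\infty$ removes the error. Continuity extends the
result to the closure. -/

section FiniteEntropy

open scoped Classical

variable {Ω Ω' A B C : Type*} [Fintype Ω] [Fintype Ω']

/-- The probability of the fibre of `Y` through `ω`. -/
noncomputable def fibreMass (p : Ω → ℝ) (Y : Ω → A) (ω : Ω) : ℝ :=
  ∑ ω', if Y ω' = Y ω then p ω' else 0

/-- The information content of the value of `Y` at `ω`. -/
noncomputable def surprisal (p : Ω → ℝ) (Y : Ω → A) (ω : Ω) : ℝ :=
  -Real.log (fibreMass p Y ω)

/-- Entropy on a finite probability space as expected surprisal. -/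
noncomputable def finiteEntropy (p : Ω → ℝ) (Y : Ω → A) : ℝ :=
  ∑ ω, p ω * surprisal p Y ω

/-- The subvector indexed by `I`. -/
def subvector {N : Type*} {X : N → Type*} (ξ : ∀ i, Ω → X i) (I : Finset N) (ω : Ω) (i : I) :
    X i := ξ i ω

/-! ### Fibres, surprisals and monotonicity of entropy. -/

omit [Fintype Ω] in
theorem subvector_eq_iff {N : Type*} {X : N → Type*} (ξ : ∀ i, Ω → X i) (I : Finset N)
    (ω ω' : Ω) : subvector ξ I ω = subvector ξ I ω' ↔ ∀ i ∈ I, ξ i ω = ξ i ω' := by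
  simp [funext_iff, subvector]

theorem fibreMass_congr (p : Ω → ℝ) {Y : Ω → A} {Z : Ω → B} {ω : Ω}
    (h : ∀ ω', Y ω' = Y ω ↔ Z ω' = Z ω) : fibreMass p Y ω = fibreMass p Z ω := by
  simp [fibreMass, h]

theorem finiteEntropy_congr (p : Ω → ℝ) {Y : Ω → A} {Z : Ω → B}
    (h : ∀ ω' ω, Y ω' = Y ω ↔ Z ω' = Z ω) : finiteEntropy p Y = finiteEntropy p Z := by
  simp only [finiteEntropy, surprisal]
  exact Finset.sum_congr rfl fun ω _ => by rw [fibreMass_congr p fun ω' => h ω' ω]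

theorem fibreMass_pos {p : Ω → ℝ} (hp : ∀ ω, 0 < p ω) (Y : Ω → A) (ω : Ω) :
    0 < fibreMass p Y ω := by
  refine Finset.sum_pos' (fun ω' _ => ?_) ⟨ω, Finset.mem_univ _, by simpa using hp ω⟩
  split_ifs
  exacts [(hp ω').le, le_rfl]

theorem fibreMass_eq_of_eq (p : Ω → ℝ) {Y : Ω → A} {ω ω' : Ω} (h : Y ω' = Y ω) :
    fibreMass p Y ω' = fibreMass p Y ω := by
  simp [fibreMass, h]

theorem fibreMass_mono {p : Ω → ℝ} (hp : ∀ ω, 0 < p ω) {Y : Ω → A} {Z : Ω → B} {ω : Ω}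
    (h : ∀ ω', Y ω' = Y ω → Z ω' = Z ω) : fibreMass p Y ω ≤ fibreMass p Z ω := by
  refine Finset.sum_le_sum fun ω' _ => ?_
  by_cases h1 : Y ω' = Y ω
  · simp [h1, h ω' h1]
  · simp only [h1, if_false]
    split_ifs
    exacts [(hp ω').le, le_rfl]

theorem surprisal_mono {p : Ω → ℝ} (hp : ∀ ω, 0 < p ω) {Y : Ω → A} {Z : Ω → B} {ω : Ω}
    (h : ∀ ω', Y ω' = Y ω → Z ω' = Z ω) : surprisal p Z ω ≤ surprisal p Y ω :=
  neg_le_neg (Real.log_le_log (fibreMass_pos hp Y ω) (fibreMass_mono hp h))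

theorem finiteEntropy_mono {p : Ω → ℝ} (hp : ∀ ω, 0 < p ω) {Y : Ω → A} {Z : Ω → B}
    (h : ∀ ω' ω, Y ω' = Y ω → Z ω' = Z ω) : finiteEntropy p Z ≤ finiteEntropy p Y :=
  Finset.sum_le_sum fun ω _ =>
    mul_le_mul_of_nonneg_left (surprisal_mono hp fun ω' => h ω' ω) (hp ω).le

theorem fibreMass_of_subsingleton {p : Ω → ℝ} (hp1 : ∑ ω, p ω = 1) {Y : Ω → A}
    (h : ∀ ω' ω, Y ω' = Y ω) (ω : Ω) : fibreMass p Y ω = 1 := by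
  simp [fibreMass, fun ω' => h ω' ω, hp1]

theorem finiteEntropy_of_subsingleton {p : Ω → ℝ} (hp1 : ∑ ω, p ω = 1) {Y : Ω → A}
    (h : ∀ ω' ω, Y ω' = Y ω) : finiteEntropy p Y = 0 := by
  simp [finiteEntropy, surprisal, fibreMass_of_subsingleton hp1 h]

/-! ### Gibbs' inequality and its consequences. -/

/-- The sum is 1 if `a` is attained by `Y` and 0 otherwise. -/
theorem sum_fibre_div_fibreMass_le_one {p : Ω → ℝ} (hp : ∀ ω, 0 < p ω) (Y : Ω → A) (a : A) :
    ∑ ω, (if Y ω = a then p ω / fibreMass p Y ω else 0) ≤ 1 := by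
  by_cases h : ∃ ω₀, Y ω₀ = a
  · obtain ⟨ω₀, rfl⟩ := h
    have : ∀ ω, (if Y ω = Y ω₀ then p ω / fibreMass p Y ω else 0)
        = (if Y ω = Y ω₀ then p ω else 0) / fibreMass p Y ω₀ := by
      intro ω
      split_ifs with h
      · rw [fibreMass_eq_of_eq p h]
      · simp
    simp_rw [this, ← Finset.sum_div]
    exact (div_self (fibreMass_pos hp Y ω₀).ne').le
  · push Not at h
    simp [h]

/-- Gibbs' inequality, from $\log x\le x-1$. The function `q` plays the role of a likelihood ratio.
-/
theorem sum_mul_log_nonpos {p q : Ω → ℝ} (hp : ∀ ω, 0 < p ω) (hp1 : ∑ ω, p ω = 1)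
    (hq : ∀ ω, 0 < q ω) (h : ∑ ω, p ω * q ω ≤ 1) : ∑ ω, p ω * Real.log (q ω) ≤ 0 := by
  calc ∑ ω, p ω * Real.log (q ω) ≤ ∑ ω, p ω * (q ω - 1) :=
        Finset.sum_le_sum fun ω _ =>
          mul_le_mul_of_nonneg_left (Real.log_le_sub_one_of_pos (hq ω)) (hp ω).le
    _ = ∑ ω, p ω * q ω - 1 := by simp [mul_sub, hp1]
    _ ≤ 0 := by linarith

theorem finiteEntropy_le_log_card [Fintype A] [Nonempty A] {p : Ω → ℝ} (hp : ∀ ω, 0 < p ω)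
    (hp1 : ∑ ω, p ω = 1) (Y : Ω → A) : finiteEntropy p Y ≤ Real.log (Fintype.card A) := by
  have hM : (0 : ℝ) < Fintype.card A := by exact_mod_cast Fintype.card_pos
  have key := sum_mul_log_nonpos hp hp1 (q := fun ω => (fibreMass p Y ω * Fintype.card A)⁻¹)
    (fun ω => inv_pos.2 (mul_pos (fibreMass_pos hp Y ω) hM)) (by
      have h1 : ∑ ω, p ω / fibreMass p Y ω ≤ Fintype.card A := by
        calc ∑ ω, p ω / fibreMass p Y ω
            = ∑ a : A, ∑ ω, (if Y ω = a then p ω / fibreMass p Y ω else 0) := by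
              rw [Finset.sum_comm]; simp
          _ ≤ ∑ _a : A, (1 : ℝ) :=
              Finset.sum_le_sum fun a _ => sum_fibre_div_fibreMass_le_one hp Y a
          _ = Fintype.card A := by simp
      calc ∑ ω, p ω * (fibreMass p Y ω * Fintype.card A)⁻¹
          = (∑ ω, p ω / fibreMass p Y ω) / Fintype.card A := by
            rw [Finset.sum_div]
            exact Finset.sum_congr rfl fun ω _ => by rw [mul_inv]; ring
        _ ≤ 1 := (div_le_one hM).2 h1)
  have : ∑ ω, p ω * Real.log (fibreMass p Y ω * Fintype.card A)⁻¹
      = finiteEntropy p Y - Real.log (Fintype.card A) := by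
    rw [finiteEntropy, ← one_mul (Real.log (Fintype.card A)), ← hp1, Finset.sum_mul,
      ← Finset.sum_sub_distrib]
    refine Finset.sum_congr rfl fun ω _ => ?_
    rw [Real.log_inv, Real.log_mul (fibreMass_pos hp Y ω).ne' hM.ne', surprisal]
    ring
  linarith

/-- Conditioning on a coarser variable increases the conditional entropy. -/
theorem finiteEntropy_submodular {p : Ω → ℝ} (hp : ∀ ω, 0 < p ω) (hp1 : ∑ ω, p ω = 1)
    {Y : Ω → A} {Z : Ω → B} (hYZ : ∀ ω' ω, Y ω' = Y ω → Z ω' = Z ω) (W : Ω → C) :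
    finiteEntropy p (fun ω => (Y ω, W ω)) - finiteEntropy p Y
      ≤ finiteEntropy p (fun ω => (Z ω, W ω)) - finiteEntropy p Z := by
  set mY := fibreMass p Y with hmY
  set mZ := fibreMass p Z with hmZ
  set mYW := fibreMass p (fun ω => (Y ω, W ω)) with hmYW
  set mZW := fibreMass p (fun ω => (Z ω, W ω)) with hmZW
  have pY := fibreMass_pos hp Y
  have pZ := fibreMass_pos hp Z
  have pYW := fibreMass_pos hp (fun ω => (Y ω, W ω))
  have pZW := fibreMass_pos hp (fun ω => (Z ω, W ω))
  have hsum : ∑ ω, p ω * (mY ω * mZW ω / (mYW ω * mZ ω)) ≤ 1 := by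
    -- Draw `a` from `p`, then `b` from `p` conditioned on `Z b = Z a`. The pair `(Y a, W b)` makes
    -- `Y` and `W` conditionally independent given `Z`, and the likelihood ratio compares its law
    -- with that of `(Y, W)`. The sum in `hsum` is thus the mass of a part of a probability law.
    have expand : ∀ ω, p ω * (mY ω * mZW ω / (mYW ω * mZ ω))
        = ∑ a, ∑ b, (if Z b = Z a then p a * p b / mZ a else 0) *
            (if Y ω = Y a ∧ W ω = W b then p ω / mYW ω else 0) := by
      intro ω
      have : p ω * (mY ω * mZW ω / (mYW ω * mZ ω)) = p ω / mYW ω / mZ ω * (mY ω * mZW ω) := by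
        have := (pYW ω).ne'
        have := (pZ ω).ne'
        field_simp
      rw [this, hmY, hmZW, fibreMass, fibreMass, Finset.sum_mul_sum, Finset.mul_sum]
      refine Finset.sum_congr rfl fun a _ => ?_
      rw [Finset.mul_sum]
      refine Finset.sum_congr rfl fun b _ => ?_
      by_cases h1 : Y a = Y ω
      · have hz := hYZ _ _ h1
        have hm : mZ a = mZ ω := fibreMass_eq_of_eq p hz
        by_cases h2 : Z b = Z ω <;> by_cases h3 : W b = W ω
        · simp [h1, h2, h3, hz, hm]; ring
        · simp [h3, Ne.symm h3]
        · simp [h1, h2, h3, hz]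
        · simp [h3, Ne.symm h3]
      · simp [h1, Ne.symm h1]
    calc ∑ ω, p ω * (mY ω * mZW ω / (mYW ω * mZ ω))
        = ∑ a, ∑ b, (if Z b = Z a then p a * p b / mZ a else 0) *
            ∑ ω, (if Y ω = Y a ∧ W ω = W b then p ω / mYW ω else 0) := by
          simp_rw [expand]
          rw [Finset.sum_comm]
          refine Finset.sum_congr rfl fun a _ => ?_
          rw [Finset.sum_comm]
          simp_rw [Finset.mul_sum]
      _ ≤ ∑ a, ∑ b, (if Z b = Z a then p a * p b / mZ a else 0) * 1 := by
          refine Finset.sum_le_sum fun a _ => Finset.sum_le_sum fun b _ => ?_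
          refine mul_le_mul_of_nonneg_left ?_ ?_
          · simpa using sum_fibre_div_fibreMass_le_one hp (fun ω => (Y ω, W ω)) (Y a, W b)
          · split_ifs
            · exact div_nonneg (mul_pos (hp a) (hp b)).le (pZ a).le
            · exact le_rfl
      _ = ∑ a, p a := by
          refine Finset.sum_congr rfl fun a _ => ?_
          have : ∀ b, (if Z b = Z a then p a * p b / mZ a else 0) * 1
              = p a / mZ a * (if Z b = Z a then p b else 0) := by
            intro b
            split_ifs
            · ring
            · simp
          simp_rw [this, ← Finset.mul_sum]
          exact div_mul_cancel₀ _ (pZ a).ne'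
      _ ≤ 1 := hp1.le
  have key := sum_mul_log_nonpos hp hp1
    (fun ω => div_pos (mul_pos (pY ω) (pZW ω)) (mul_pos (pYW ω) (pZ ω))) hsum
  have : ∑ ω, p ω * Real.log (mY ω * mZW ω / (mYW ω * mZ ω))
      = finiteEntropy p (fun ω => (Y ω, W ω)) - finiteEntropy p Y
      - (finiteEntropy p (fun ω => (Z ω, W ω)) - finiteEntropy p Z) := by
    simp only [finiteEntropy, ← Finset.sum_sub_distrib]
    refine Finset.sum_congr rfl fun ω _ => ?_
    rw [Real.log_div (mul_pos (pY ω) (pZW ω)).ne' (mul_pos (pYW ω) (pZ ω)).ne',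
      Real.log_mul (pY ω).ne' (pZW ω).ne', Real.log_mul (pYW ω).ne' (pZ ω).ne']
    simp only [surprisal]
    ring
  linarith

/-! ### Product spaces. -/

theorem fibreMass_prod (p : Ω → ℝ) (q : Ω' → ℝ) {Y : Ω → A} {Z : Ω' → B} {V : Ω × Ω' → C}
    {x : Ω × Ω'} (h : ∀ y, V y = V x ↔ Y y.1 = Y x.1 ∧ Z y.2 = Z x.2) :
    fibreMass (fun x : Ω × Ω' => p x.1 * q x.2) V x = fibreMass p Y x.1 * fibreMass q Z x.2 := by
  simp only [fibreMass, h, Finset.sum_mul_sum, Fintype.sum_prod_type]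
  refine Finset.sum_congr rfl fun a _ => Finset.sum_congr rfl fun b _ => ?_
  by_cases h1 : Y a = Y x.1 <;> by_cases h2 : Z b = Z x.2 <;> simp [h1, h2]

theorem surprisal_prod {p : Ω → ℝ} {q : Ω' → ℝ} (hp : ∀ ω, 0 < p ω) (hq : ∀ ω, 0 < q ω)
    {Y : Ω → A} {Z : Ω' → B} {V : Ω × Ω' → C} {x : Ω × Ω'}
    (h : ∀ y, V y = V x ↔ Y y.1 = Y x.1 ∧ Z y.2 = Z x.2) :
    surprisal (fun x : Ω × Ω' => p x.1 * q x.2) V x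
      = surprisal p Y x.1 + surprisal q Z x.2 := by
  rw [surprisal, fibreMass_prod p q h,
    Real.log_mul (fibreMass_pos hp _ _).ne' (fibreMass_pos hq _ _).ne', surprisal, surprisal]
  ring

theorem sum_prod_mul_add {p : Ω → ℝ} {q : Ω' → ℝ} (hp1 : ∑ ω, p ω = 1) (hq1 : ∑ ω, q ω = 1)
    (f : Ω → ℝ) (g : Ω' → ℝ) :
    ∑ x : Ω × Ω', p x.1 * q x.2 * (f x.1 + g x.2) = ∑ ω, p ω * f ω + ∑ ω, q ω * g ω := by
  have : ∀ a b, p a * q b * (f a + g b) = p a * f a * q b + p a * (q b * g b) := by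
    intros; ring
  simp [Fintype.sum_prod_type, this, Finset.sum_add_distrib, ← Finset.mul_sum, ← Finset.sum_mul,
    hp1, hq1]

theorem sum_prod_mul {p : Ω → ℝ} {q : Ω' → ℝ} (hp1 : ∑ ω, p ω = 1) (hq1 : ∑ ω, q ω = 1) :
    ∑ x : Ω × Ω', p x.1 * q x.2 = 1 := by
  simp [Fintype.sum_prod_type, ← Finset.mul_sum, hp1, hq1]

theorem finiteEntropy_prod {p : Ω → ℝ} {q : Ω' → ℝ} (hp : ∀ ω, 0 < p ω) (hq : ∀ ω, 0 < q ω)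
    (hp1 : ∑ ω, p ω = 1) (hq1 : ∑ ω, q ω = 1)
    {Y : Ω → A} {Z : Ω' → B} {V : Ω × Ω' → C}
    (h : ∀ y x, V y = V x ↔ Y y.1 = Y x.1 ∧ Z y.2 = Z x.2) :
    finiteEntropy (fun x : Ω × Ω' => p x.1 * q x.2) V
      = finiteEntropy p Y + finiteEntropy q Z := by
  simp only [finiteEntropy]
  rw [← sum_prod_mul_add hp1 hq1]
  exact Finset.sum_congr rfl fun x _ => by rw [surprisal_prod hp hq fun y => h y x]

/-! ### Random hashing. -/

/-- Averaged over all functions into `ZMod M`, two distinct points collide with frequency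
`1 / M`. -/
theorem sum_collision [Fintype A] (M : ℕ) [NeZero M] {a b : A} (hab : a ≠ b) :
    (M : ℝ) * ∑ f : A → ZMod M, (if f a = f b then (1 : ℝ) else 0)
      = (Fintype.card (A → ZMod M) : ℝ) := by
  -- Adding `c` to the value at `a` permutes the functions; for each `f` exactly one `c` then gives
  -- a collision.
  have shift : ∀ c : ZMod M, ∑ f : A → ZMod M, (if f a = f b then (1 : ℝ) else 0)
      = ∑ f : A → ZMod M, (if c = f b - f a then (1 : ℝ) else 0) := by
    intro c
    rw [← Equiv.sum_comp (Equiv.addRight (Pi.single a c : A → ZMod M))]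
    refine Finset.sum_congr rfl fun f _ => ?_
    simp [hab.symm, eq_sub_iff_add_eq, add_comm]
  calc (M : ℝ) * ∑ f : A → ZMod M, (if f a = f b then (1 : ℝ) else 0)
      = ∑ _c : ZMod M, ∑ f : A → ZMod M, (if f a = f b then (1 : ℝ) else 0) := by
        simp [ZMod.card]
    _ = ∑ c : ZMod M, ∑ f : A → ZMod M, (if c = f b - f a then (1 : ℝ) else 0) :=
        Finset.sum_congr rfl fun c _ => shift c
    _ = (Fintype.card (A → ZMod M) : ℝ) := by
        rw [Finset.sum_comm]
        simp

/-- Some function `f` into `ZMod M` makes `f ∘ X` nearly uniform given `Y`. -/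
theorem exists_hash [Fintype A] (M : ℕ) [NeZero M] {p : Ω → ℝ} (hp : ∀ ω, 0 < p ω)
    (X : Ω → A) (Y : Ω → B) :
    ∃ f : A → ZMod M,
      ∑ ω, p ω * -Real.log
          (Real.exp (-(surprisal p (fun ω => (Y ω, X ω)) ω - surprisal p Y ω)) + (M : ℝ)⁻¹)
        ≤ finiteEntropy p (fun ω => (Y ω, f (X ω))) - finiteEntropy p Y := by
  have hM : (0 : ℝ) < M := by exact_mod_cast Nat.pos_of_ne_zero (NeZero.ne M)
  set K : ℝ := ((Fintype.card (A → ZMod M) : ℕ) : ℝ) with hK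
  have hKpos : 0 < K := by rw [hK]; exact_mod_cast Fintype.card_pos
  have pY := fibreMass_pos hp Y
  have pYX := fibreMass_pos hp (fun ω => (Y ω, X ω))
  have hexp : ∀ ω, Real.exp (-(surprisal p (fun ω => (Y ω, X ω)) ω - surprisal p Y ω))
      = fibreMass p (fun ω => (Y ω, X ω)) ω / fibreMass p Y ω := by
    intro ω
    rw [surprisal, surprisal, neg_sub, sub_neg_eq_add, neg_add_eq_sub, Real.exp_sub,
      Real.exp_log (pY ω), Real.exp_log (pYX ω)]
  simp_rw [hexp]
  set c : Ω → ℝ := fun ω => fibreMass p (fun ω => (Y ω, X ω)) ω / fibreMass p Y ω + (M : ℝ)⁻¹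
    with hc
  have cpos : ∀ ω, 0 < c ω := fun ω => add_pos (div_pos (pYX ω) (pY ω)) (inv_pos.2 hM)
  -- Points with equal `X` always collide, all others with frequency $1/M$.
  have avg : ∀ ω, ∑ f : A → ZMod M, fibreMass p (fun ω => (Y ω, f (X ω))) ω
      ≤ K * (c ω * fibreMass p Y ω) := by
    intro ω
    have hcm : c ω * fibreMass p Y ω
        = fibreMass p (fun ω => (Y ω, X ω)) ω + (M : ℝ)⁻¹ * fibreMass p Y ω := by
      rw [hc, add_mul, div_mul_cancel₀ _ (pY ω).ne']
    rw [hcm]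
    simp only [fibreMass]
    rw [Finset.sum_comm, Finset.mul_sum, ← Finset.sum_add_distrib, Finset.mul_sum]
    refine Finset.sum_le_sum fun ω' _ => ?_
    by_cases h1 : Y ω' = Y ω
    · by_cases h2 : X ω' = X ω
      · simp only [h1, h2, if_true, Finset.sum_const, nsmul_eq_mul,
          Finset.card_univ, ← hK]
        refine mul_le_mul_of_nonneg_left ?_ hKpos.le
        have := mul_pos (inv_pos.2 hM) (hp ω')
        linarith
      · have := sum_collision M h2
        simp only [h1, h2, Prod.mk.injEq, true_and, and_false, if_true, if_false, zero_add]
        have h3 : ∑ f : A → ZMod M, (if f (X ω') = f (X ω) then p ω' else 0)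
            = p ω' * ∑ f : A → ZMod M, (if f (X ω') = f (X ω) then 1 else 0) := by
          rw [Finset.mul_sum]
          exact Finset.sum_congr rfl fun f _ => by simp
        rw [h3, hK, ← this]
        apply le_of_eq
        field_simp
    · simp [h1]
  have main : ∑ _f : A → ZMod M, ∑ ω, p ω * -Real.log (c ω)
      ≤ ∑ f : A → ZMod M, (finiteEntropy p (fun ω => (Y ω, f (X ω))) - finiteEntropy p Y) := by
    simp only [finiteEntropy, ← Finset.sum_sub_distrib]
    rw [Finset.sum_comm, Finset.sum_comm (s := (Finset.univ : Finset (A → ZMod M)))]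
    refine Finset.sum_le_sum fun ω _ => ?_
    simp_rw [← mul_sub, ← Finset.mul_sum]
    refine mul_le_mul_of_nonneg_left ?_ (hp ω).le
    -- Jensen's inequality for $-\log$, via the tangent at `c ω * fibreMass p Y ω`, which bounds the
    -- average over `f` of the fibre mass.
    have tangent : ∀ f : A → ZMod M, -Real.log (c ω) + 1
        - fibreMass p (fun ω => (Y ω, f (X ω))) ω / (c ω * fibreMass p Y ω)
        ≤ surprisal p (fun ω => (Y ω, f (X ω))) ω - surprisal p Y ω := by
      intro f
      have pf := fibreMass_pos hp (fun ω => (Y ω, f (X ω))) ω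
      have hcy := mul_pos (cpos ω) (pY ω)
      have := Real.log_le_sub_one_of_pos (div_pos pf hcy)
      rw [Real.log_div pf.ne' hcy.ne', Real.log_mul (cpos ω).ne' (pY ω).ne'] at this
      rw [surprisal, surprisal]
      linarith
    refine le_trans ?_ (Finset.sum_le_sum fun f _ => tangent f)
    rw [Finset.sum_sub_distrib, ← Finset.sum_div]
    have hcy := mul_pos (cpos ω) (pY ω)
    have := (div_le_iff₀ hcy).2 (avg ω)
    simp only [Finset.sum_const, nsmul_eq_mul, Finset.card_univ, ← hK]
    linarith
  obtain ⟨f, -, hf⟩ := Finset.exists_le_of_sum_le Finset.univ_nonempty main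
  exact ⟨f, hf⟩

end FiniteEntropy

/-! ### The entropy region and its closure as a convex cone. -/

section Region

open scoped Classical
universe u

variable {N : Type u} [DecidableEq N]

theorem finiteEntropy_eq_sum_negMulLog {Ω A : Type*} [Fintype Ω] [Fintype A] (p : Ω → ℝ)
    (Y : Ω → A) :
    finiteEntropy p Y = ∑ a, Real.negMulLog (∑ ω, if Y ω = a then p ω else 0) := by
  calc finiteEntropy p Y
      = ∑ ω, ∑ a, (if Y ω = a then p ω else 0)
          * -Real.log (∑ ω', if Y ω' = a then p ω' else 0) := by
        refine Finset.sum_congr rfl fun ω _ => ?_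
        simp [surprisal, fibreMass]
    _ = _ := by
        rw [Finset.sum_comm]
        refine Finset.sum_congr rfl fun a _ => ?_
        rw [← Finset.sum_mul, Real.negMulLog]
        ring

/-- Any random vector on a finite probability space gives a point of the entropy region,
whatever the universes of its sample space and its value types. -/
theorem finiteEntropy_mem_entropyRegion {Ω : Type*} [Fintype Ω] {p : Ω → ℝ}
    (hp : ∀ ω, 0 < p ω) (hp1 : ∑ ω, p ω = 1) {X : N → Type*} (ξ : ∀ i, Ω → X i) :
    (fun I => finiteEntropy p (subvector ξ I)) ∈ entropyRegion N := by
  set e := Fintype.equivFin Ω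
  have hsum : ∑ j, ENNReal.ofReal (p (e.symm j)) = 1 := by
    rw [← ENNReal.ofReal_sum_of_nonneg fun _ _ => (hp _).le, Equiv.sum_comp e.symm, hp1,
      ENNReal.ofReal_one]
  let P := PMF.ofFintype (fun j => ENNReal.ofReal (p (e.symm j))) hsum
  -- Each value of `ξ i` is recoded as its fibre, a subset of `Fin (Fintype.card Ω)`: this makes the
  -- value types finite and lowers them to `Type`.
  refine ⟨Fin (Fintype.card Ω), ⊤, @PMF.toMeasure _ ⊤ P, @PMF.toMeasure.isProbabilityMeasure _ ⊤ P,
    fun _ => Set (Fin (Fintype.card Ω)), fun _ => inferInstance,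
    fun i j => {k | ξ i (e.symm k) = ξ i (e.symm j)}, fun i => fun _ _ => trivial, ?_⟩
  have hP : ∀ s : Set (Fin (Fintype.card Ω)), (@PMF.toMeasure _ ⊤ P).real s
      = ∑ j, if j ∈ s then p (e.symm j) else 0 := by
    intro s
    let _ : MeasurableSpace (Fin (Fintype.card Ω)) := ⊤
    rw [Measure.real, PMF.toMeasure_apply_fintype, ENNReal.toReal_sum]
    · refine Finset.sum_congr rfl fun j _ => ?_
      by_cases hj : j ∈ s <;> simp [hj, P, (hp _).le]
    · intro j _
      by_cases hj : j ∈ s <;> simp [hj, P]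
  funext I
  rw [entropyFunction, shannonEntropy]
  simp_rw [hP]
  let Y : Fin (Fintype.card Ω) → ∀ _i : I, Set (Fin (Fintype.card Ω)) :=
    fun j i => {k | ξ i (e.symm k) = ξ i (e.symm j)}
  have hY : ∀ ω' ω, subvector ξ I ω' = subvector ξ I ω ↔ Y (e ω') = Y (e ω) := by
    intro ω' ω
    rw [subvector_eq_iff]
    constructor
    · intro h
      funext i
      simp [Y, h i i.2]
    · intro h i hi
      have h1 := congrFun h ⟨i, hi⟩
      have h2 : e ω' ∈ Y (e ω') ⟨i, hi⟩ := by simp [Y]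
      rw [h1] at h2
      simpa [Y] using h2
  rw [finiteEntropy_congr p hY, finiteEntropy_eq_sum_negMulLog]
  have : ∀ a, (∑ ω, if Y (e ω) = a then p ω else 0)
      = ∑ j, if j ∈ Y ⁻¹' {a} then p (e.symm j) else 0 := by
    intro a
    rw [← Equiv.sum_comp e]
    simp
  refine Finset.sum_congr (by congr!) fun a _ => ?_
  exact congrArg Real.negMulLog (by convert this a)

/-- Every entropic function comes from a finite probability space without null atoms. -/
theorem exists_finiteEntropy_of_mem_entropyRegion [Fintype N] {h : Finset N → ℝ}
    (hh : h ∈ entropyRegion N) :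
    ∃ (Ω : Type u) (_ : Fintype Ω) (p : Ω → ℝ) (X : N → Type) (ξ : ∀ i, Ω → X i),
      (∀ ω, 0 < p ω) ∧ ∑ ω, p ω = 1 ∧ h = fun I => finiteEntropy p (subvector ξ I) := by
  obtain ⟨Ω, _, P, _, X, _, ξ, hξ, rfl⟩ := hh
  have hmeas : ∀ x : ∀ i, X i, MeasurableSet ((fun ω i => ξ i ω) ⁻¹' {x}) := by
    intro x
    have : (fun ω i => ξ i ω) ⁻¹' {x} = ⋂ i, ξ i ⁻¹' {x i} := by
      ext ω; simp [funext_iff]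
    rw [this]
    exact MeasurableSet.iInter fun i => hξ i trivial
  set q : (∀ i, X i) → ℝ := fun x => P.real ((fun ω i => ξ i ω) ⁻¹' {x}) with hq
  have hq0 : ∀ x, 0 ≤ q x := fun x => measureReal_nonneg
  have hpre : ∀ s : Set (∀ i, X i), P.real ((fun ω i => ξ i ω) ⁻¹' s)
      = ∑ x, if x ∈ s then q x else 0 := by
    intro s
    have : (fun ω i => ξ i ω) ⁻¹' s
        = ⋃ x ∈ Finset.univ.filter (· ∈ s), (fun ω i => ξ i ω) ⁻¹' {x} := by
      ext ω; simp
    rw [this, measureReal_biUnion_finset]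
    · rw [Finset.sum_filter]
    · intro x _ y _ hxy
      exact Disjoint.preimage _ (by simpa using hxy)
    · exact fun x _ => hmeas x
  have hsub : ∀ f : (∀ i, X i) → ℝ, (∀ x, q x = 0 → f x = 0) →
      ∑ x : {x // 0 < q x}, f x = ∑ x, f x := by
    intro f hf
    rw [← Finset.sum_subtype (Finset.univ.filter (0 < q ·)) (by simp) f]
    exact Finset.sum_filter_of_ne fun x _ hx =>
      lt_of_le_of_ne (hq0 x) fun h0 => hx (hf x h0.symm)
  -- The sample space is the support of the joint law.
  refine ⟨{x // 0 < q x}, inferInstance, fun x => q x, X, fun i x => x.1 i, fun x => x.2, ?_, ?_⟩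
  · rw [hsub q fun _ h => h]
    simpa using (hpre Set.univ).symm
  · funext I
    rw [finiteEntropy_eq_sum_negMulLog, entropyFunction, shannonEntropy]
    refine Finset.sum_congr (by congr!) fun a _ => ?_
    congr 1
    have h1 := hpre {x | (fun i : I => x i) = a}
    rw [← hsub _ (by simp +contextual)] at h1
    convert h1
    · rfl
    · rfl

theorem zero_mem_entropyRegion : (0 : Finset N → ℝ) ∈ entropyRegion N := by
  have := finiteEntropy_mem_entropyRegion (N := N) (Ω := Unit) (p := fun _ => 1) (by simp)
    (by simp) (X := fun _ => Unit) (fun _ _ => ())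
  convert this using 1
  funext I
  exact (finiteEntropy_of_subsingleton (by simp) (by simp)).symm

theorem add_mem_entropyRegion [Fintype N] {g h : Finset N → ℝ} (hg : g ∈ entropyRegion N)
    (hh : h ∈ entropyRegion N) : g + h ∈ entropyRegion N := by
  obtain ⟨Ω, _, p, X, ξ, hp, hp1, rfl⟩ := exists_finiteEntropy_of_mem_entropyRegion hg
  obtain ⟨Ω', _, q, X', ξ', hq, hq1, rfl⟩ := exists_finiteEntropy_of_mem_entropyRegion hh
  convert finiteEntropy_mem_entropyRegion (p := fun x : Ω × Ω' => p x.1 * q x.2)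
    (fun x => mul_pos (hp _) (hq _)) (sum_prod_mul hp1 hq1)
    (fun i x => (ξ i x.1, ξ' i x.2)) using 1
  funext I
  refine (finiteEntropy_prod hp hq hp1 hq1 fun y x => ?_).symm
  simp [subvector_eq_iff, forall_and]

/-- Mixing with a constant vector scales the entropies up to the entropy of the selector. -/
theorem exists_mem_entropyRegion_scaled [Fintype N] {h : Finset N → ℝ} (hh : h ∈ entropyRegion N)
    {t : ℝ} (ht0 : 0 < t) (ht1 : t < 1) :
    ∃ g ∈ entropyRegion N, ∀ I, g I = t * h I + if I = ∅ then 0 else Real.binEntropy t := by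
  obtain ⟨Ω, _, p, X, ξ, hp, hp1, rfl⟩ := exists_finiteEntropy_of_mem_entropyRegion hh
  -- At `none` all components take an extra value, so every nonempty subvector reveals the selector,
  -- while the empty one reveals nothing.
  let q : Option Ω → ℝ := fun o => o.elim (1 - t) (fun ω => t * p ω)
  have hq1 : ∑ o, q o = 1 := by
    simp [q, Fintype.sum_option, ← Finset.mul_sum, hp1]
  refine ⟨_, finiteEntropy_mem_entropyRegion (p := q) ?_ hq1 (fun i o => o.map (ξ i)), ?_⟩
  · rintro (_ | ω)
    · simpa [q] using ht1
    · exact mul_pos ht0 (hp ω)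
  · intro I
    by_cases hI : I = ∅
    · subst hI
      have h1 := finiteEntropy_of_subsingleton hp1 (Y := subvector ξ ∅)
        fun ω' ω => by simp [subvector_eq_iff]
      rw [finiteEntropy_of_subsingleton hq1 fun ω' ω => by simp [subvector_eq_iff]]
      simp [h1]
    · obtain ⟨i₀, hi₀⟩ := Finset.nonempty_iff_ne_empty.2 hI
      set V := subvector (fun i (o : Option Ω) => o.map (ξ i)) I with hV
      have h1 : ∀ ω, V none ≠ V (some ω) := by
        intro ω h
        have := (subvector_eq_iff _ _ _ _).1 h i₀ hi₀
        simp at this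
      have h2 : ∀ ω' ω, V (some ω') = V (some ω) ↔ subvector ξ I ω' = subvector ξ I ω := by
        intro ω' ω
        simp [hV, subvector_eq_iff]
      have m1 : fibreMass q V none = 1 - t := by
        simp [fibreMass, Fintype.sum_option, (h1 _).symm, q]
      have m2 : ∀ ω, fibreMass q V (some ω) = t * fibreMass p (subvector ξ I) ω := by
        intro ω
        simp [fibreMass, Fintype.sum_option, h1, q, h2, Finset.mul_sum]
      have h3 : ∀ ω, q (some ω) * surprisal q V (some ω)
          = t * (p ω * surprisal p (subvector ξ I) ω) + p ω * (t * -Real.log t) := by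
        intro ω
        rw [surprisal, m2, Real.log_mul ht0.ne' (fibreMass_pos hp _ _).ne', surprisal]
        simp only [q, Option.elim]
        ring
      rw [finiteEntropy, Fintype.sum_option]
      simp_rw [h3]
      rw [Finset.sum_add_distrib, ← Finset.mul_sum, ← Finset.sum_mul, hp1, surprisal, m1,
        if_neg hI, Real.binEntropy_eq_negMulLog_add_negMulLog_one_sub, Real.negMulLog,
        Real.negMulLog, finiteEntropy]
      simp only [q, Option.elim]
      ring

theorem AlmostEntropic.add [Fintype N] {g h : Finset N → ℝ} (hg : AlmostEntropic g)
    (hh : AlmostEntropic h) : AlmostEntropic (g + h) :=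
  map_mem_closure₂ continuous_add hg hh fun _ ha _ hb => add_mem_entropyRegion ha hb

theorem nsmul_mem_entropyRegion [Fintype N] {h : Finset N → ℝ} (hh : h ∈ entropyRegion N)
    (n : ℕ) : (n : ℝ) • h ∈ entropyRegion N := by
  induction n with
  | zero => simpa using zero_mem_entropyRegion
  | succ n ih =>
    rw [Nat.cast_succ, add_smul, one_smul]
    exact add_mem_entropyRegion ih hh

/-- Write $c = (c/n)\cdot n$: take $n$ independent copies and mix with a constant at $t=c/n$. The
excess is the binary entropy of $c/n$, which tends to 0. -/
theorem AlmostEntropic.smul [Fintype N] {h : Finset N → ℝ} (hh : AlmostEntropic h) {c : ℝ}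
    (hc : 0 ≤ c) : AlmostEntropic (c • h) := by
  rcases hc.eq_or_lt with rfl | hc
  · rw [zero_smul]
    exact subset_closure zero_mem_entropyRegion
  suffices H : ∀ h ∈ entropyRegion N, c • h ∈ closure (entropyRegion N) by
    have := map_mem_closure (continuous_const_smul c) hh H
    rwa [closure_closure] at this
  intro h hh
  have hlim : Filter.Tendsto (fun n : ℕ => c / (n : ℝ)) Filter.atTop (nhds 0) :=
    tendsto_const_div_atTop_nhds_zero_nat c
  have hev : ∀ᶠ n : ℕ in Filter.atTop, 0 < n ∧ c / (n : ℝ) < 1 :=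
    (Filter.eventually_gt_atTop 0).and (hlim.eventually_lt_const one_pos)
  have hg : ∀ n : ℕ, ∃ g : Finset N → ℝ, (0 < n ∧ c / (n : ℝ) < 1) → g ∈ entropyRegion N ∧
      ∀ I, g I = c * h I + if I = ∅ then 0 else Real.binEntropy (c / n) := by
    intro n
    by_cases hn : 0 < n ∧ c / (n : ℝ) < 1
    · have hn0 : (0 : ℝ) < n := by exact_mod_cast hn.1
      obtain ⟨g, hg, hg'⟩ := exists_mem_entropyRegion_scaled (nsmul_mem_entropyRegion hh n)
        (div_pos hc hn0) hn.2
      refine ⟨g, fun _ => ⟨hg, fun I => ?_⟩⟩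
      rw [hg', Pi.smul_apply, smul_eq_mul, ← mul_assoc, div_mul_cancel₀ _ hn0.ne']
    · exact ⟨0, fun h => absurd h hn⟩
  choose g hg using hg
  refine mem_closure_of_tendsto (f := g) (b := Filter.atTop) ?_ (hev.mono fun n hn => (hg n hn).1)
  rw [tendsto_pi_nhds]
  intro I
  have hbin : Filter.Tendsto (fun n : ℕ => Real.binEntropy (c / n)) Filter.atTop (nhds 0) := by
    simpa [Function.comp_def] using (Real.binEntropy_continuous.tendsto 0).comp hlim
  have : Filter.Tendsto (fun n : ℕ => c * h I + if I = ∅ then 0 else Real.binEntropy (c / n))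
      Filter.atTop (nhds (c * h I)) := by
    split_ifs
    · simp
    · simpa using hbin.const_add (c * h I)
  exact this.congr' (hev.mono fun n hn => ((hg n hn).2 I).symm)

theorem AlmostEntropic.sum [Fintype N] {ι : Type*} (s : Finset ι) {g : ι → Finset N → ℝ}
    (hg : ∀ i ∈ s, AlmostEntropic (g i)) : AlmostEntropic (∑ i ∈ s, g i) := by
  induction s using Finset.induction_on with
  | empty => exact subset_closure zero_mem_entropyRegion
  | insert a s ha ih =>
    rw [Finset.sum_insert ha]
    exact (hg a (by simp)).add (ih fun i hi => hg i (by simp [hi]))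

/-- Averaging over the values of `W`, the conditional entropies given `W` are almost entropic. -/
theorem almostEntropic_conditional [Fintype N] {Ω A : Type*} [Fintype Ω] {p : Ω → ℝ}
    (hp : ∀ ω, 0 < p ω) {X : N → Type*} (ξ : ∀ i, Ω → X i) (W : Ω → A) :
    AlmostEntropic fun I =>
      finiteEntropy p (fun ω => (subvector ξ I ω, W ω)) - finiteEntropy p W := by
  have pW := fibreMass_pos hp W
  have hsub : ∀ (ω₀ : Ω) (f : Ω → ℝ), ∑ ω : {ω // W ω = W ω₀}, f ω
      = ∑ ω, if W ω = W ω₀ then f ω else 0 := by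
    intro ω₀ f
    rw [← Finset.sum_filter]
    exact (Finset.sum_subtype _ (by simp) f).symm
  let q : ∀ ω₀ : Ω, {ω // W ω = W ω₀} → ℝ := fun ω₀ ω => p ω / fibreMass p W ω₀
  have hq : ∀ ω₀ ω, 0 < q ω₀ ω := fun ω₀ ω => div_pos (hp _) (pW _)
  have hq1 : ∀ ω₀, ∑ ω, q ω₀ ω = 1 := by
    intro ω₀
    simp only [q]
    rw [← Finset.sum_div, hsub ω₀ p]
    exact div_self (pW ω₀).ne'
  have hmem : ∀ ω₀, AlmostEntropic fun I =>
      finiteEntropy (q ω₀) (subvector (fun i (ω : {ω // W ω = W ω₀}) => ξ i ω) I) :=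
    fun ω₀ => subset_closure (finiteEntropy_mem_entropyRegion (hq ω₀) (hq1 ω₀) _)
  -- Summing over outcomes `ω₀` with weight `p ω₀` gives each value of `W` its probability as total
  -- weight.
  have hsumm := AlmostEntropic.sum Finset.univ fun ω₀ _ => (hmem ω₀).smul (hp ω₀).le
  convert hsumm using 1
  funext I
  set V := fun ω => (subvector ξ I ω, W ω) with hV
  have pV := fibreMass_pos hp V
  have hmass : ∀ ω₀ (ω : {ω // W ω = W ω₀}),
      fibreMass (q ω₀) (subvector (fun i (ω : {ω // W ω = W ω₀}) => ξ i ω) I) ω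
        = fibreMass p V ω / fibreMass p W ω := by
    intro ω₀ ω
    rw [fibreMass_eq_of_eq p ω.2, fibreMass, fibreMass, Finset.sum_div]
    have h1 := hsub ω₀ (fun ω' => if subvector ξ I ω' = subvector ξ I ω then
      p ω' / fibreMass p W ω₀ else 0)
    refine Eq.trans ?_ (h1.trans ?_)
    · exact Finset.sum_congr rfl fun ω' _ => by simp [subvector_eq_iff, q]
    · refine Finset.sum_congr rfl fun ω' _ => ?_
      by_cases ha : W ω' = W ω₀ <;> by_cases hb : subvector ξ I ω' = subvector ξ I ω <;>
        simp [hV, ha, hb, ω.2]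
  have hent : ∀ ω₀,
      finiteEntropy (q ω₀) (subvector (fun i (ω : {ω // W ω = W ω₀}) => ξ i ω) I)
        = ∑ ω, if W ω = W ω₀ then
            p ω / fibreMass p W ω₀ * (surprisal p V ω - surprisal p W ω) else 0 := by
    intro ω₀
    rw [← hsub ω₀ fun ω => p ω / fibreMass p W ω₀ * (surprisal p V ω - surprisal p W ω)]
    refine Finset.sum_congr rfl fun ω _ => ?_
    rw [surprisal, hmass, Real.log_div (pV ω).ne' (pW ω).ne', surprisal, surprisal]
    simp only [q]
    ring
  simp only [Finset.sum_apply, Pi.smul_apply, smul_eq_mul, hent, Finset.mul_sum]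
  rw [Finset.sum_comm]
  simp only [finiteEntropy, ← Finset.sum_sub_distrib]
  refine Finset.sum_congr rfl fun ω _ => ?_
  have : ∀ ω₀, p ω₀ * (if W ω = W ω₀ then
      p ω / fibreMass p W ω₀ * (surprisal p V ω - surprisal p W ω) else 0)
      = p ω / fibreMass p W ω * (surprisal p V ω - surprisal p W ω)
        * (if W ω₀ = W ω then p ω₀ else 0) := by
    intro ω₀
    by_cases h : W ω = W ω₀
    · simp [h, fibreMass_eq_of_eq p h]; ring
    · simp [h, Ne.symm h]
  simp_rw [this, ← Finset.mul_sum]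
  change _ = _ * fibreMass p W ω
  have := (pW ω).ne'
  field_simp

end Region

/-! ### Tightening at one element. -/

section Tightening

open scoped Classical
universe u

variable {N : Type u} [DecidableEq N]

omit [DecidableEq N] in
/-- A random vector on a finite space and its `n`-fold independent copy: entropies and the variance
of any difference of two surprisals are multiplied by `n`. -/
theorem exists_iid_copies {Ω : Type u} [Fintype Ω] {p : Ω → ℝ} (hp : ∀ ω, 0 < p ω)
    (hp1 : ∑ ω, p ω = 1) {X : N → Type} (ξ : ∀ i, Ω → X i) (I J : Finset N) (n : ℕ) :
    ∃ (Ω' : Type u) (_ : Fintype Ω') (q : Ω' → ℝ) (Y : N → Type) (η : ∀ i, Ω' → Y i),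
      (∀ ω, 0 < q ω) ∧ ∑ ω, q ω = 1 ∧
      (∀ K, finiteEntropy q (subvector η K) = n * finiteEntropy p (subvector ξ K)) ∧
      ∑ ω, q ω * (surprisal q (subvector η I) ω - surprisal q (subvector η J) ω
          - n * (finiteEntropy p (subvector ξ I) - finiteEntropy p (subvector ξ J))) ^ 2
        = n * ∑ ω, p ω * (surprisal p (subvector ξ I) ω - surprisal p (subvector ξ J) ω
          - (finiteEntropy p (subvector ξ I) - finiteEntropy p (subvector ξ J))) ^ 2 := by
  induction n with
  | zero =>
    refine ⟨PUnit, inferInstance, fun _ => 1, fun _ => Unit, fun _ _ => (), by simp, by simp,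
      fun K => ?_, ?_⟩
    · simp [finiteEntropy_of_subsingleton]
    · simp [surprisal, fibreMass]
  | succ n ih =>
    obtain ⟨Ω', _, q, Y, η, hq, hq1, hent, hvar⟩ := ih
    have hV : ∀ K (y x : Ω × Ω'),
        subvector (fun i (x : Ω × Ω') => (ξ i x.1, η i x.2)) K y
          = subvector (fun i (x : Ω × Ω') => (ξ i x.1, η i x.2)) K x
        ↔ subvector ξ K y.1 = subvector ξ K x.1 ∧ subvector η K y.2 = subvector η K x.2 := by
      intro K y x
      simp [subvector_eq_iff, forall_and]
    refine ⟨Ω × Ω', inferInstance, fun x => p x.1 * q x.2, fun i => X i × Y i,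
      fun i x => (ξ i x.1, η i x.2), fun x => mul_pos (hp _) (hq _), sum_prod_mul hp1 hq1,
      fun K => ?_, ?_⟩
    · rw [finiteEntropy_prod hp hq hp1 hq1 (hV K), hent]
      push_cast
      ring
    · simp_rw [surprisal_prod hp hq fun y => hV I y _, surprisal_prod hp hq fun y => hV J y _]
      set t := finiteEntropy p (subvector ξ I) - finiteEntropy p (subvector ξ J) with ht
      set a : Ω → ℝ := fun ω => surprisal p (subvector ξ I) ω - surprisal p (subvector ξ J) ω - t
        with ha
      set b : Ω' → ℝ := fun ω => surprisal q (subvector η I) ω - surprisal q (subvector η J) ω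
        - n * t with hb
      -- Centring makes the cross term vanish, so variances add.
      have hb0 : ∑ ω, q ω * b ω = 0 := by
        have : ∑ ω, q ω * b ω = finiteEntropy q (subvector η I) - finiteEntropy q (subvector η J)
            - n * t := by
          simp only [hb, mul_sub, Finset.sum_sub_distrib, finiteEntropy, ← Finset.sum_mul, hq1]
          ring
        rw [this, hent, hent, ht]
        ring
      calc ∑ x : Ω × Ω', p x.1 * q x.2 *
            (surprisal p (subvector ξ I) x.1 + surprisal q (subvector η I) x.2
              - (surprisal p (subvector ξ J) x.1 + surprisal q (subvector η J) x.2)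
              - ((n + 1 : ℕ) : ℝ) * t) ^ 2
          = ∑ x : Ω × Ω', (p x.1 * q x.2 * (a x.1 ^ 2 + b x.2 ^ 2)
              + 2 * (p x.1 * a x.1) * (q x.2 * b x.2)) := by
            refine Finset.sum_congr rfl fun x _ => ?_
            simp only [ha, hb]
            push_cast
            ring
        _ = ∑ ω, p ω * a ω ^ 2 + ∑ ω, q ω * b ω ^ 2 := by
            rw [Finset.sum_add_distrib,
              sum_prod_mul_add hp1 hq1 (fun ω => a ω ^ 2) (fun ω => b ω ^ 2),
              Fintype.sum_prod_type]
            simp [← Finset.mul_sum, hb0]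
        _ = ((n + 1 : ℕ) : ℝ) * ∑ ω, p ω * a ω ^ 2 := by
            rw [hvar]
            push_cast
            ring

/-- The tight part of `h` at the single element `i`. -/
def tightenAt [Fintype N] (i : N) (h : Finset N → ℝ) : Finset N → ℝ :=
  fun I => h I - if i ∈ I then h Finset.univ - h (Finset.univ.erase i) else 0

/-- Both summands in the logarithm are at most $e^{-c+|D-c|}$; having two of them costs $\log 2$. -/
theorem le_neg_log_exp_add_inv {D c M : ℝ} (hM : Real.exp c ≤ M) :
    c - |D - c| - Real.log 2 ≤ -Real.log (Real.exp (-D) + M⁻¹) := by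
  have h1 : M⁻¹ ≤ Real.exp (-c + |D - c|) := by
    calc M⁻¹ ≤ (Real.exp c)⁻¹ := inv_anti₀ (Real.exp_pos c) hM
      _ = Real.exp (-c) := (Real.exp_neg c).symm
      _ ≤ _ := Real.exp_le_exp.2 (by linarith [abs_nonneg (D - c)])
  have h2 : Real.exp (-D) ≤ Real.exp (-c + |D - c|) :=
    Real.exp_le_exp.2 (by linarith [neg_abs_le (D - c)])
  have h3 : Real.log (Real.exp (-D) + M⁻¹) ≤ Real.log (2 * Real.exp (-c + |D - c|)) :=
    Real.log_le_log (add_pos (Real.exp_pos _) (inv_pos.2 ((Real.exp_pos c).trans_le hM)))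
      (by linarith)
  rw [Real.log_mul two_ne_zero (Real.exp_pos _).ne', Real.log_exp] at h3
  linarith

/-- One-shot tightening: a function `W` of `ξ i` of about `exp c` values, nearly uniform
given the other components, is conditioned on. The error is governed by the deviation from `c` of
the information content of `ξ i` given the other components. -/
theorem exists_almostEntropic_near_tightenAt [Fintype N] {Ω : Type*} [Fintype Ω] {p : Ω → ℝ}
    (hp : ∀ ω, 0 < p ω) (hp1 : ∑ ω, p ω = 1) {X : N → Type*} (ξ : ∀ i, Ω → X i) (i : N)
    {c : ℝ} (hc : 0 ≤ c) :
    ∃ g : Finset N → ℝ, AlmostEntropic g ∧ ∀ I,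
      |g I - (finiteEntropy p (subvector ξ I) - if i ∈ I then c else 0)|
        ≤ 2 * Real.log 2 + ∑ ω, p ω * |surprisal p (subvector ξ Finset.univ) ω
            - surprisal p (subvector ξ (Finset.univ.erase i)) ω - c| := by
  set M := ⌈Real.exp c⌉₊
  have hM : Real.exp c ≤ M := Nat.le_ceil _
  have hM0 : (0 : ℝ) < M := (Real.exp_pos c).trans_le hM
  have : NeZero M := ⟨by rintro h; simp [h] at hM0⟩
  have hlogM : Real.log M ≤ c + Real.log 2 := by
    have h1 : (M : ℝ) ≤ 2 * Real.exp c := by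
      have := Nat.ceil_lt_add_one (Real.exp_pos c).le
      have := Real.one_le_exp hc
      linarith
    have h2 := Real.log_le_log hM0 h1
    rw [Real.log_mul two_ne_zero (Real.exp_pos c).ne', Real.log_exp] at h2
    linarith
  set Y := subvector ξ (Finset.univ.erase i) with hY
  -- Restricting to the range provides the finite domain that hashing needs.
  let x : Ω → Set.range (ξ i) := fun ω => ⟨ξ i ω, ω, rfl⟩
  obtain ⟨f, hf⟩ := exists_hash M hp x Y
  set W : Ω → ZMod M := fun ω => f (x ω) with hW
  have hYx : ∀ ω, surprisal p (fun ω => (Y ω, x ω)) ω = surprisal p (subvector ξ Finset.univ) ω := by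
    intro ω
    rw [surprisal, surprisal, fibreMass_congr]
    intro ω'
    simp only [hY, Prod.mk.injEq, subvector_eq_iff, x, Finset.mem_erase,
      Finset.mem_univ, and_true, forall_const]
    refine ⟨fun h j => ?_, fun h => ⟨fun j _ => h j, Subtype.ext (h i)⟩⟩
    by_cases hj : j = i
    · subst hj; exact congrArg Subtype.val h.2
    · exact h.1 j hj
  set S := ∑ ω, p ω * |surprisal p (subvector ξ Finset.univ) ω - surprisal p Y ω - c| with hS
  have hS0 : 0 ≤ S := Finset.sum_nonneg fun ω _ => mul_nonneg (hp ω).le (abs_nonneg _)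
  have hWY : c - Real.log 2 - S ≤ finiteEntropy p (fun ω => (Y ω, W ω)) - finiteEntropy p Y := by
    refine le_trans ?_ hf
    have : c - Real.log 2 - S = ∑ ω, p ω * (c - |surprisal p (subvector ξ Finset.univ) ω
        - surprisal p Y ω - c| - Real.log 2) := by
      simp only [hS, mul_sub, Finset.sum_sub_distrib, ← Finset.sum_mul, hp1]
      ring
    rw [this]
    refine Finset.sum_le_sum fun ω _ => mul_le_mul_of_nonneg_left ?_ (hp ω).le
    rw [hYx]
    exact le_neg_log_exp_add_inv hM
  have hWM : finiteEntropy p W ≤ Real.log M := by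
    simpa [ZMod.card] using finiteEntropy_le_log_card hp hp1 W
  have htriv : ∀ {B : Type _} (Z : Ω → B),
      finiteEntropy p (fun ω => (Z ω, W ω)) - finiteEntropy p Z ≤ finiteEntropy p W := by
    intro B Z
    have h1 := finiteEntropy_submodular hp hp1 (Y := Z) (Z := fun _ => ()) (by simp) W
    rwa [finiteEntropy_of_subsingleton hp1 (Y := fun _ : Ω => ()) (by simp), sub_zero,
      finiteEntropy_congr (Y := fun ω => ((), W ω)) (Z := W) p (by simp)] at h1
  -- If `i ∈ I`, `W` is a function of the subvector and exactly $H(W)\approx c$ is lost. Otherwise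
  -- the loss is the mutual information of `W` with a function of `Y`, at most $\log M - H(W\mid
  -- Y)$.
  refine ⟨_, almostEntropic_conditional hp ξ W, fun I => ?_⟩
  have hWlow := hWY.trans (htriv Y)
  by_cases hi : i ∈ I
  · have : finiteEntropy p (fun ω => (subvector ξ I ω, W ω)) = finiteEntropy p (subvector ξ I) := by
      refine finiteEntropy_congr p fun ω' ω => ?_
      simp only [Prod.mk.injEq, and_iff_left_iff_imp, subvector_eq_iff]
      intro h
      simp [hW, x, h i hi]
    rw [this, if_pos hi, abs_le]
    constructor <;> linarith [Real.log_pos one_lt_two]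
  · have h1 := finiteEntropy_submodular hp hp1 (Y := Y) (Z := subvector ξ I) (by
      intro ω' ω
      rw [subvector_eq_iff, subvector_eq_iff]
      exact fun h j hj => h j (by simp; rintro rfl; exact hi hj)) W
    have h2 := htriv (subvector ξ I)
    rw [if_neg hi, abs_le]
    constructor <;> linarith [Real.log_pos one_lt_two]

theorem almostEntropic_tightenAt_of_mem [Fintype N] {h : Finset N → ℝ} (hh : h ∈ entropyRegion N)
    (i : N) : AlmostEntropic (tightenAt i h) := by
  obtain ⟨Ω, _, p, X, ξ, hp, hp1, rfl⟩ := exists_finiteEntropy_of_mem_entropyRegion hh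
  set t := finiteEntropy p (subvector ξ Finset.univ)
    - finiteEntropy p (subvector ξ (Finset.univ.erase i)) with ht
  have ht0 : 0 ≤ t := sub_nonneg.2 <| finiteEntropy_mono hp fun ω' ω => by
    rw [subvector_eq_iff, subvector_eq_iff]
    exact fun h j _ => h j (Finset.mem_univ j)
  set V := ∑ ω, p ω * (surprisal p (subvector ξ Finset.univ) ω
    - surprisal p (subvector ξ (Finset.univ.erase i)) ω - t) ^ 2 with hV
  have hg : ∀ n : ℕ, ∃ g : Finset N → ℝ, AlmostEntropic g ∧ ∀ I, 0 < n →
      |g I - tightenAt i (fun I => finiteEntropy p (subvector ξ I)) I|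
        ≤ 2 * Real.log 2 * (1 / n) + (V + 1) / 2 * (1 / √n) := by
    intro n
    obtain ⟨Ω', _, q, Y, η, hq, hq1, hent, hvar⟩ :=
      exists_iid_copies hp hp1 ξ Finset.univ (Finset.univ.erase i) n
    obtain ⟨g, hg, hgI⟩ := exists_almostEntropic_near_tightenAt hq hq1 η i
      (mul_nonneg n.cast_nonneg ht0)
    refine ⟨(n : ℝ)⁻¹ • g, hg.smul (by positivity), fun I hn => ?_⟩
    have hn0 : (0 : ℝ) < n := by exact_mod_cast hn
    have hs : 0 < √(n : ℝ) := Real.sqrt_pos.2 hn0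
    have hss : √(n : ℝ) * √(n : ℝ) = n := Real.mul_self_sqrt hn0.le
    have hdev : ∑ ω, q ω * |surprisal q (subvector η Finset.univ) ω
        - surprisal q (subvector η (Finset.univ.erase i)) ω - n * t| ≤ √n * ((V + 1) / 2) := by
      -- AM-GM balanced at $\sqrt n$, the scale of a deviation of variance $nV$.
      have habs : ∀ u : ℝ, |u| ≤ u ^ 2 * (1 / (2 * √n)) + √n / 2 := by
        intro u
        have h1 : u ^ 2 * (1 / (2 * √n)) + √n / 2 - |u| = (|u| - √n) ^ 2 / (2 * √n) := by
          rw [← sq_abs u]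
          field_simp
          ring
        have h2 : 0 ≤ (|u| - √n) ^ 2 / (2 * √n) := by positivity
        linarith
      refine (Finset.sum_le_sum fun ω _ =>
        mul_le_mul_of_nonneg_left (habs _) (hq ω).le).trans_eq ?_
      simp_rw [mul_add, ← mul_assoc]
      rw [Finset.sum_add_distrib, ← Finset.sum_mul, ← Finset.sum_mul, hq1, hvar]
      nth_rewrite 1 [← hss]
      field_simp
      rfl
    have key := (hgI I).trans (add_le_add_right hdev _)
    rw [hent] at key
    have heq : ((n : ℝ)⁻¹ • g) I - tightenAt i (fun I => finiteEntropy p (subvector ξ I)) I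
        = (n : ℝ)⁻¹ * (g I - (n * finiteEntropy p (subvector ξ I)
            - if i ∈ I then n * t else 0)) := by
      simp only [tightenAt, Pi.smul_apply, smul_eq_mul, ← ht]
      split_ifs
      · field_simp
      · field_simp
        ring
    rw [heq, abs_mul, abs_of_pos (inv_pos.2 hn0)]
    refine (mul_le_mul_of_nonneg_left key (inv_pos.2 hn0).le).trans_eq ?_
    have : (n : ℝ)⁻¹ * √n = 1 / √n := by
      nth_rewrite 1 [← hss]
      field_simp
    rw [mul_add, ← mul_assoc _ √(n : ℝ), this]
    ring
  choose g hg hgI using hg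
  unfold AlmostEntropic
  rw [← closure_closure]
  refine mem_closure_of_tendsto (f := g) (b := Filter.atTop) ?_ (.of_forall hg)
  rw [tendsto_pi_nhds]
  intro I
  rw [tendsto_iff_norm_sub_tendsto_zero]
  have hlim : Filter.Tendsto (fun n : ℕ => 2 * Real.log 2 * (1 / (n : ℝ))
      + (V + 1) / 2 * (1 / √(n : ℝ))) Filter.atTop (nhds 0) := by
    have h1 := (tendsto_const_div_atTop_nhds_zero_nat (1 : ℝ)).const_mul (2 * Real.log 2)
    have h2 : Filter.Tendsto (fun n : ℕ => 1 / √(n : ℝ)) Filter.atTop (nhds 0) :=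
      (Real.tendsto_sqrt_atTop.comp tendsto_natCast_atTop_atTop).const_div_atTop 1
    simpa using h1.add (h2.const_mul ((V + 1) / 2))
  exact squeeze_zero' (.of_forall fun _ => norm_nonneg _)
    ((Filter.eventually_gt_atTop 0).mono fun n hn => hgI n I hn) hlim

theorem AlmostEntropic.tightenAt [Fintype N] {h : Finset N → ℝ} (hh : AlmostEntropic h) (i : N) :
    AlmostEntropic (tightenAt i h) := by
  have hcont : Continuous (_root_.tightenAt (N := N) i) := by
    unfold _root_.tightenAt
    refine continuous_pi fun I => ?_
    split_ifs <;> fun_prop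
  have := map_mem_closure hcont hh fun h hh => almostEntropic_tightenAt_of_mem hh i
  exact closure_closure.subset this

end Tightening

/-! ### Tightening at all elements. -/

/-- Elements can be treated one at a time: for $a\notin S$, tightening on $S$ subtracts the same sum
from $h(N)$ and $h(N\setminus a)$, leaving their difference unchanged. -/
theorem almostEntropic_sub_sum_inter {N : Type*} [Fintype N] [DecidableEq N] {h : Finset N → ℝ}
    (hh : AlmostEntropic h) (S : Finset N) :
    AlmostEntropic fun I =>
      h I - ∑ i ∈ I ∩ S, (h Finset.univ - h (Finset.univ.erase i)) := by
  induction S using Finset.induction_on with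
  | empty => simpa using hh
  | insert a S ha ih =>
    have := ih.tightenAt a
    convert this using 1
    funext I
    have h1 : Finset.univ.erase a ∩ S = S :=
      Finset.inter_eq_right.2 fun j hj => by simp; rintro rfl; exact ha hj
    simp only [tightenAt, h1, Finset.univ_inter, sub_sub_sub_cancel_right]
    by_cases hI : a ∈ I
    · rw [Finset.inter_insert_of_mem hI, Finset.sum_insert (by simp [ha]), if_pos hI]
      ring
    · rw [Finset.inter_insert_of_notMem hI, if_neg hI, sub_zero]

theorem theoremT {N : Type*} [Fintype N] [DecidableEq N] (h : Finset N → ℝ)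
    (hh : AlmostEntropic h) : AlmostEntropic (tightPart h) := by
  have := almostEntropic_sub_sum_inter hh Finset.univ
  simp_rw [Finset.inter_univ] at this
  exact this
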